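/- Let ${\tt U}$ be an (additively) optimal universal prefix computer, and for a finite binary string $s$ let $K(s\,|\,n,m)$ be the length of a shortest program with which ${\tt U}$, given the integers $n$ and $m$, prints $s$ and halts. For ${\bf u}\in[0,1]^n$ let $K({\bf u}\,|\,n,m)$ be the least value of $K(s\,|\,n,m)$ over the binary strings $s$ that are the concatenation of $n$ finite binary expansions, of one common length, of $u_1,\ldots,u_n$ (and $\infty$ if there is none), and for ${\bf x}\in[0,1]^n$ let \[ K^{[\cdot]_m}({\bf x}) = \inf\{K({\bf u}\,|\,n,m) : {\bf u}\in[0,1]^n,\ \|{\bf x}-{\bf u}\|_\infty\le 2^{-m}\}. \] Let $0<p<1$, and let $\log$ denote either the natural logarithm or the logarithm to base $2$ (the statement holds for each of the two choices). For $n\ge 1$ put $d=\lceil 3n^{p/2}\log n\rceil$, $m=\lceil\log_2 n\rceil$ and $\kappa=3n^{p/2}$. Then there is an $n_0$, which depends only on $p$, ${\tt U}$ and the choice of $\log$, such that for all $n\ge n_0$ and all ${\bf x}_o\in[0,1]^n$ with $\|{\bf x}_o\|_p=(\sum_i|x_{o,i}|^p)^{1/p}\le1$ the following holds. For every $A\in\mathbb{R}^{d\times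 n}$ and ${\bf y}_o=A{\bf x}_o$ the problem \[ \min \|{\bf y}_o-A{\bf x}\|_2^2\quad\text{subject to}\quad {\bf x}\in[0,1]^n,\ K^{[\cdot]_m}({\bf x})\le\kappa m \] has a minimizer; and if $A$ is a random $d\times n$ matrix with i.i.d. $\mathcal{N}(0,1)$ entries, and ${\bf \hat{x}}_o$ is (almost surely) any minimizer, then \[ \mathbb{P}\Big(\|{\bf x}_o-{\bf \hat{x}}_o\|_2>\frac{7}{\sqrt{\log n}}\Big)\le 2{\rm e}^{-0.5d}. \] -/

import Mathlib

open MeasureTheory ProbabilityTheory Filter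
open scoped ENNReal

noncomputable section

namespace MCP

/-- A (conditional) prefix computer. It receives a program in `{0,1}^*` and a pair of natural
numbers as side information, and, when it halts, prints a binary string. It computes a partial
recursive function, and for every side information no halting program is a proper prefix of
another one. -/
structure PrefixComputer where
  /-- `run (p, y)` is the output on program `p` with side information `y`. -/
  run : List Bool × (ℕ × ℕ) →. List Bool
  partrec : Partrec run
  prefixFree : ∀ (y : ℕ × ℕ) (p q : List Bool),
    (run (p, y)).Dom → (run (q, y)).Dom → p <+: q → p = q

/-- The prefix Kolmogorov complexity `K_U(s | y)`: the length of a shortest program that makes `U`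
print `s` and halt, when `U` has access to `y` (it is `⊤` if there is no such program). -/
def condK (U : PrefixComputer) (s : List Bool) (y : ℕ × ℕ) : ℕ∞ :=
  ⨅ (p : List Bool) (_ : s ∈ U.run (p, y)), (p.length : ℕ∞)

/-- `U` is an (additively) optimal universal computer: for every computer `C` there is a constant
`c` with `K_U(s | y) ≤ K_C(s | y) + c` for all strings `s` and all side information `y`. -/
def IsOptimal (U : PrefixComputer) : Prop :=
  ∀ C : PrefixComputer, ∃ c : ℕ, ∀ (s : List Bool) (y : ℕ × ℕ),
    condK U s y ≤ condK C s y + (c : ℕ∞)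

/-- The real number `0.b₁b₂…b_ℓ = ∑ 2⁻ⁱ bᵢ` with the given finite binary expansion. -/
def binReal : List Bool → ℝ
  | [] => 0
  | b :: s => ((if b then 1 else 0) + binReal s) / 2

/-- The string `s` is the concatenation of (finite) binary expansions, all of the same length `ℓ`,
of the components `u₁, …, u_n` of `u`. -/
def Represents {n : ℕ} (s : List Bool) (u : EuclideanSpace ℝ (Fin n)) : Prop :=
  ∃ ℓ : ℕ, 0 < ℓ ∧ s.length = n * ℓ ∧
    ∀ i : Fin n, u i = binReal ((s.drop (i * ℓ)).take ℓ)

/-- The cube `[0,1]^n`. -/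
def unitCube (n : ℕ) : Set (EuclideanSpace ℝ (Fin n)) :=
  {x | ∀ i, x i ∈ Set.Icc (0 : ℝ) 1}

/-- `K(u | n, m)` for a real vector `u`: the complexity, given `n` and `m`, of printing the
concatenated binary expansions of the components of `u` (`⊤` if these are not finite). -/
def vecK (U : PrefixComputer) (m : ℕ) {n : ℕ} (u : EuclideanSpace ℝ (Fin n)) : ℕ∞ :=
  ⨅ (s : List Bool) (_ : Represents s u), condK U s (n, m)

/-- The Kolmogorov complexity of `x` at resolution `m`: the infimum of `K(u | n, m)` over all
`u ∈ [0,1]^n` with `‖x - u‖_∞ ≤ 2^{-m}`. -/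
def resK (U : PrefixComputer) (m : ℕ) {n : ℕ} (x : EuclideanSpace ℝ (Fin n)) : ℕ∞ :=
  ⨅ (u : EuclideanSpace ℝ (Fin n)) (_ : u ∈ unitCube n)
    (_ : ∀ i, |x i - u i| ≤ (2 : ℝ)⁻¹ ^ m), vecK U m u

/-- The signals in `[0,1]^n` whose complexity at resolution `m` is at most `κ m`. -/
def lowComplexity (U : PrefixComputer) (m : ℕ) (κ : ℝ) (n : ℕ) :
    Set (EuclideanSpace ℝ (Fin n)) :=
  {x | x ∈ unitCube n ∧ (resK U m x : ℝ≥0∞) ≤ ENNReal.ofReal (κ * m)}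

/-- The product `A x`, as a vector with the Euclidean norm. -/
def meas {d n : ℕ} (A : Matrix (Fin d) (Fin n) ℝ) (x : EuclideanSpace ℝ (Fin n)) :
    EuclideanSpace ℝ (Fin d) :=
  WithLp.toLp 2 (A.mulVec x.ofLp)

/-- `xhat` is a solution of low-complexity least squares: it minimizes `‖y - A x‖₂²` over all `x`
whose complexity at resolution `m` is at most `κ m`. -/
def IsLLSSolution (U : PrefixComputer) (m : ℕ) (κ : ℝ) {d n : ℕ}
    (A : Matrix (Fin d) (Fin n) ℝ) (y : EuclideanSpace ℝ (Fin d))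
    (xhat : EuclideanSpace ℝ (Fin n)) : Prop :=
  xhat ∈ lowComplexity U m κ n ∧
    ∀ x ∈ lowComplexity U m κ n, ‖y - meas A xhat‖ ^ 2 ≤ ‖y - meas A x‖ ^ 2

/-- The `ℓ_p` unit ball `{x ∈ ℝ^n : (∑ |x_i|^p)^{1/p} ≤ 1}`. -/
def lpBall (p : ℝ) (n : ℕ) : Set (EuclideanSpace ℝ (Fin n)) :=
  {x | (∑ i, |x i| ^ p) ^ (1 / p) ≤ 1}

/-- `A` is a random matrix with i.i.d. `N(0,1)` entries. -/
def IsStdGaussianMatrix {Ω : Type*} [MeasurableSpace Ω] (P : Measure Ω) {d n : ℕ}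
    (A : Ω → Matrix (Fin d) (Fin n) ℝ) : Prop :=
  (∀ i j, HasLaw (fun ω => A ω i j) (gaussianReal 0 1) P) ∧
    iIndepFun (fun (ij : Fin d × Fin n) ω => A ω ij.1 ij.2) P

end MCP

end

/-! Write `N = n^(p/2)` and let `l` be the chosen logarithm of `n`. Approximation: zeroing the
entries of `xo` below `n^(-1/2)` leaves a vector `y` with at most `N` nonzero entries and squared
error at most `N/n`. A program listing, for each nonzero entry, `m` bits of position and `m` bits of
value has about `2Nm` bits. Optimality of `U` costs a further constant, so `y` meets the bound `3Nm`
for large `n` (`exists_mem_lowComplexity_near`).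

Recovery: the minimizer `xhat` is within `2^(-m)`, entrywise, of a vector `u` of complexity at most
`3Nm`. Minimality gives `‖A(xo - xhat)‖ ≤ ‖A(xo - y)‖`, so `‖A(xo - u)‖` is at most `‖A(xo - y)‖`
plus the quantization term `‖A(xhat - u)‖`. A lower bound for `A` on `xo - u` turns this into a
bound on `‖xo - u‖` (`IsLLSSolution.norm_sub_le`).

Probability: `A` maps a fixed unit vector to a standard Gaussian vector, so Chernoff bounds for
chi-square variables apply. There are at most `2^(L+1)` programs of length at most `L`, hence few
candidates `u`, fixed before `A` is drawn. A union bound with failure probability `e^(-3d)` each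
covers them all. The quantization term is controlled on the `2^n` sign vectors and extended to the
cube by convexity, and `xo - y` is one fixed vector. The three bad events have probability at most
`e^(-d)` each (`measure_error_le`), and `3e^(-d) ≤ 2e^(-d/2)`. -/

noncomputable section

namespace MCP

/-! ### Chi-square moment generating function and tails -/

section Gaussian

open Real in
lemma integrable_exp_sq_gaussianReal {t : ℝ} (ht : t < 1 / 2) :
    Integrable (fun x : ℝ => exp (t * x ^ 2)) (gaussianReal 0 1) := by
  rw [gaussianReal_of_var_ne_zero _ one_ne_zero, gaussianPDF_def,
    integrable_withDensity_iff_integrable_smul' (by fun_prop) (by simp)]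
  have h : Integrable (fun x : ℝ => (√(2 * π))⁻¹ * exp (-(1 / 2 - t) * x ^ 2)) :=
    (integrable_exp_neg_mul_sq (by linarith)).const_mul _
  refine h.congr (ae_of_all _ fun x => ?_)
  simp only [gaussianPDFReal, smul_eq_mul]
  rw [ENNReal.toReal_ofReal (by positivity), mul_assoc, ← exp_add]
  simp only [NNReal.coe_one, mul_one, sub_zero]
  congr 2
  ring

open Real in
lemma integral_exp_sq_gaussianReal {t : ℝ} (ht : t < 1 / 2) :
    ∫ x : ℝ, exp (t * x ^ 2) ∂(gaussianReal 0 1) = (√(1 - 2 * t))⁻¹ := by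
  rw [integral_gaussianReal_eq_integral_smul one_ne_zero]
  have h : ∀ x : ℝ, gaussianPDFReal 0 1 x • exp (t * x ^ 2) =
      (√(2 * π))⁻¹ * exp (-(1 / 2 - t) * x ^ 2) := fun x => by
    simp only [gaussianPDFReal, smul_eq_mul]
    rw [mul_assoc, ← exp_add]
    simp only [NNReal.coe_one, mul_one, sub_zero]
    congr 2
    ring
  simp_rw [h]
  have h0 : (0 : ℝ) < 1 - 2 * t := by linarith
  rw [integral_const_mul, integral_gaussian,
    show π / (1 / 2 - t) = (2 * π) / (1 - 2 * t) by field_simp, sqrt_div (by positivity)]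
  field_simp

open Real in
lemma integrable_exp_normSq_stdGaussian (d : ℕ) {t : ℝ} (ht : t < 1 / 2) :
    Integrable (fun x : EuclideanSpace ℝ (Fin d) => exp (t * ‖x‖ ^ 2)) (stdGaussian _) := by
  rw [← map_pi_eq_stdGaussian, integrable_map_measure (by fun_prop) (by fun_prop)]
  have h := Integrable.fintype_prod (f := fun (_ : Fin d) (x : ℝ) => exp (t * x ^ 2))
    (μ := fun _ => gaussianReal 0 1) fun _ => integrable_exp_sq_gaussianReal ht
  refine h.congr (ae_of_all _ fun x => ?_)
  simp [EuclideanSpace.real_norm_sq_eq, ← exp_sum, Finset.mul_sum]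

open Real in
lemma mgf_normSq_stdGaussian (d : ℕ) {t : ℝ} (ht : t < 1 / 2) :
    mgf (fun x : EuclideanSpace ℝ (Fin d) => ‖x‖ ^ 2) (stdGaussian _) t =
      (√(1 - 2 * t))⁻¹ ^ d := by
  rw [mgf, ← map_pi_eq_stdGaussian, integral_map (by fun_prop) (by fun_prop)]
  have h := integral_fintype_prod_eq_prod (f := fun (_ : Fin d) (x : ℝ) => exp (t * x ^ 2))
    (μ := fun _ => gaussianReal 0 1)
  rw [Finset.prod_congr rfl fun _ _ => integral_exp_sq_gaussianReal ht] at h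
  simp only [Finset.prod_const, Finset.card_univ, Fintype.card_fin] at h
  rw [← h]
  refine integral_congr_ae (ae_of_all _ fun x => ?_)
  simp [EuclideanSpace.real_norm_sq_eq, ← exp_sum, Finset.mul_sum]

/-- Upper tail of a chi-square variable. -/
lemma stdGaussian_normSq_ge (d : ℕ) (c : ℝ) :
    (stdGaussian (EuclideanSpace ℝ (Fin d))).real {x | 12 * c ≤ ‖x‖ ^ 2} ≤
      Real.exp (-3 * c + d / 2) := by
  -- Chernoff at `t = 1/4`: the threshold contributes `e^(-3c)`, and the moment generating function
  -- is `√2 ^ d ≤ e^(d/2)`.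
  refine (measure_ge_le_exp_mul_mgf (t := 1 / 4) (12 * c) (by norm_num)
    (integrable_exp_normSq_stdGaussian d (by norm_num))).trans ?_
  rw [mgf_normSq_stdGaussian d (by norm_num), Real.exp_add]
  have h : (√(1 - 2 * (1 / 4)))⁻¹ ≤ Real.exp (1 / 2) := by
    rw [← Real.sqrt_inv, Real.sqrt_le_left (Real.exp_pos _).le, ← Real.exp_nat_mul]
    have := Real.add_one_le_exp (1 : ℝ)
    norm_num
    linarith
  have h2 : (√(1 - 2 * (1 / 4)))⁻¹ ^ d ≤ Real.exp (d / 2) := by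
    refine (pow_le_pow_left₀ (by positivity) h d).trans_eq ?_
    rw [← Real.exp_nat_mul]; ring_nf
  refine mul_le_mul (le_of_eq ?_) h2 (by positivity) (by positivity)
  ring_nf

/-- The ratio by which the lower tail of a chi-square variable is truncated. -/
def tailRatio : ℝ := (Real.exp 8 - 1) / 2

lemma tailRatio_pos : 0 < tailRatio := by
  have := Real.add_one_le_exp (8 : ℝ)
  unfold tailRatio; linarith

/-- Lower tail of a chi-square variable. -/
lemma stdGaussian_normSq_le (d : ℕ) :
    (stdGaussian (EuclideanSpace ℝ (Fin d))).real {x | ‖x‖ ^ 2 ≤ d / tailRatio} ≤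
      Real.exp (-3 * d) := by
  have hr := tailRatio_pos
  -- `tailRatio` is chosen so that `1 + 2 * tailRatio = e^8`. The moment generating function at
  -- `-tailRatio` is then `e^(-4d)`, and the threshold costs `e^d`.
  refine (measure_le_le_exp_mul_mgf (t := -tailRatio) (d / tailRatio) (by linarith)
    (integrable_exp_normSq_stdGaussian d (by linarith))).trans ?_
  rw [mgf_normSq_stdGaussian d (by linarith), neg_neg, mul_div_cancel₀ _ hr.ne',
    show 1 - 2 * -tailRatio = Real.exp 4 ^ 2 by
      rw [← Real.exp_nat_mul, tailRatio]; norm_num; ring,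
    Real.sqrt_sq (Real.exp_pos _).le, ← Real.exp_neg, ← Real.exp_nat_mul, ← Real.exp_add]
  apply le_of_eq
  ring_nf

end Gaussian

/-! ### Gaussian matrices acting on fixed vectors -/

section Meas

variable {Ω : Type*} [MeasurableSpace Ω] {P : Measure Ω} [IsProbabilityMeasure P] {d n : ℕ}
  {A : Ω → Matrix (Fin d) (Fin n) ℝ}

lemma IsStdGaussianMatrix.hasLaw_entries (hA : IsStdGaussianMatrix P A) :
    HasLaw (fun ω => WithLp.toLp 2 fun ij : Fin d × Fin n => A ω ij.1 ij.2)
      (stdGaussian (EuclideanSpace ℝ (Fin d × Fin n))) P := by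
  have hm : ∀ ij : Fin d × Fin n, AEMeasurable (fun ω => A ω ij.1 ij.2) P :=
    fun ij => (hA.1 ij.1 ij.2).aemeasurable
  have h := (iIndepFun_iff_map_fun_eq_pi_map hm).1 hA.2
  simp_rw [(hA.1 _ _).map_eq] at h
  have hm' : AEMeasurable (fun ω => fun ij : Fin d × Fin n => A ω ij.1 ij.2) P :=
    aemeasurable_pi_iff.2 hm
  refine ⟨by fun_prop, ?_⟩
  rw [← map_pi_eq_stdGaussian, ← h, AEMeasurable.map_map_of_aemeasurable (by fun_prop) hm']
  rfl

lemma meas_smul (B : Matrix (Fin d) (Fin n) ℝ) (c : ℝ) (v : EuclideanSpace ℝ (Fin n)) :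
    meas B (c • v) = c • meas B v := by
  simp [meas, Matrix.mulVec_smul]

lemma meas_sub (B : Matrix (Fin d) (Fin n) ℝ) (v w : EuclideanSpace ℝ (Fin n)) :
    meas B (v - w) = meas B v - meas B w := by
  simp [meas, Matrix.mulVec_sub]

/-- The image of a fixed unit vector under a standard Gaussian matrix is a standard Gaussian
vector. -/
lemma IsStdGaussianMatrix.hasLaw_meas (hA : IsStdGaussianMatrix P A)
    {v : EuclideanSpace ℝ (Fin n)} (hv : ‖v‖ = 1) :
    HasLaw (fun ω => meas (A ω) v) (stdGaussian (EuclideanSpace ℝ (Fin d))) P := by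
  set T : EuclideanSpace ℝ (Fin d × Fin n) → EuclideanSpace ℝ (Fin d) :=
    fun x => WithLp.toLp 2 fun i => ∑ j, x (i, j) * v j with hT
  have hTm : Measurable T := by
    rw [hT]; fun_prop
  suffices h : HasLaw T (stdGaussian _) (stdGaussian (EuclideanSpace ℝ (Fin d × Fin n))) from
    h.comp hA.hasLaw_entries
  refine ⟨hTm.aemeasurable, ?_⟩
  -- Characteristic functions: `⟨Av, t⟩` is the pairing of the entries of `A` with `w = t ⊗ v`, and
  -- `‖w‖ = ‖t‖` because `‖v‖ = 1`.
  apply Measure.ext_of_charFun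
  ext t
  set w : EuclideanSpace ℝ (Fin d × Fin n) := WithLp.toLp 2 fun ij => t ij.1 * v ij.2 with hw
  have hwn : ‖w‖ ^ 2 = ‖t‖ ^ 2 := by
    have : ‖w‖ ^ 2 = ‖t‖ ^ 2 * ‖v‖ ^ 2 := by
      simp only [EuclideanSpace.real_norm_sq_eq, hw, Fintype.sum_prod_type, mul_pow,
        Finset.sum_mul_sum]
    rw [this, hv]; ring
  have hin : ∀ x, inner ℝ (T x) t = inner ℝ x w := fun x => by
    simp only [hT, hw, PiLp.inner_apply, Fintype.sum_prod_type, RCLike.inner_apply, conj_trivial,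
      Finset.mul_sum]
    exact Finset.sum_congr rfl fun i _ => Finset.sum_congr rfl fun j _ => by ring
  rw [charFun_stdGaussian]
  have h2 := charFun_stdGaussian w
  rw [charFun_apply] at h2 ⊢
  rw [integral_map hTm.aemeasurable (by fun_prop)]
  simp_rw [hin, h2]
  norm_cast
  rw [hwn]

/-- Homogeneity reduces to a unit vector. The strict inequality makes the event empty for `v = 0`,
so no case distinction is needed in the union bounds. -/
lemma IsStdGaussianMatrix.meas_normSq_ge (hA : IsStdGaussianMatrix P A)
    (v : EuclideanSpace ℝ (Fin n)) (c : ℝ) :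
    P {ω | 12 * c * ‖v‖ ^ 2 < ‖meas (A ω) v‖ ^ 2} ≤ ENNReal.ofReal (Real.exp (-3 * c + d / 2)) := by
  by_cases hv : v = 0
  · simp [hv, meas]
  have hn : 0 < ‖v‖ := norm_pos_iff.2 hv
  have hlaw := hA.hasLaw_meas (v := ‖v‖⁻¹ • v) (by rw [norm_smul]; simp [hn.ne'])
  refine (measure_mono (t := {ω | 12 * c ≤ ‖meas (A ω) (‖v‖⁻¹ • v)‖ ^ 2}) ?_).trans ?_
  · intro ω hω
    simp only [Set.mem_ofPred_eq, meas_smul, norm_smul, norm_inv, norm_norm, mul_pow,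
      inv_pow] at hω ⊢
    rw [inv_mul_eq_div, le_div_iff₀ (by positivity)]
    exact hω.le
  · rw [hlaw.measure_eq (p := fun x => 12 * c ≤ ‖x‖ ^ 2)
      (measurableSet_le (by fun_prop) (by fun_prop)), ← ofReal_measureReal]
    exact ENNReal.ofReal_le_ofReal (stdGaussian_normSq_ge d c)

lemma IsStdGaussianMatrix.meas_normSq_le (hA : IsStdGaussianMatrix P A)
    (v : EuclideanSpace ℝ (Fin n)) :
    P {ω | ‖meas (A ω) v‖ ^ 2 < d / tailRatio * ‖v‖ ^ 2} ≤
      ENNReal.ofReal (Real.exp (-3 * d)) := by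
  by_cases hv : v = 0
  · simp [hv, meas]
  have hn : 0 < ‖v‖ := norm_pos_iff.2 hv
  have hlaw := hA.hasLaw_meas (v := ‖v‖⁻¹ • v) (by rw [norm_smul]; simp [hn.ne'])
  refine (measure_mono (t := {ω | ‖meas (A ω) (‖v‖⁻¹ • v)‖ ^ 2 ≤ d / tailRatio}) ?_).trans ?_
  · intro ω hω
    simp only [Set.mem_ofPred_eq, meas_smul, norm_smul, norm_inv, norm_norm, mul_pow,
      inv_pow] at hω ⊢
    rw [inv_mul_eq_div, div_le_iff₀ (by positivity)]
    exact hω.le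
  · rw [hlaw.measure_eq (p := fun x => ‖x‖ ^ 2 ≤ d / tailRatio)
      (measurableSet_le (by fun_prop) (by fun_prop)), ← ofReal_measureReal]
    exact ENNReal.ofReal_le_ofReal (stdGaussian_normSq_le d)

/-- A bound on the vertices of a cube extends to the cube. -/
lemma norm_meas_le_of_signs (B : Matrix (Fin d) (Fin n) ℝ) {M r : ℝ} (hr : 0 ≤ r)
    (hM : ∀ s : Fin n → Bool, ‖meas B (WithLp.toLp 2 fun i => if s i then 1 else -1)‖ ≤ M)
    (w : EuclideanSpace ℝ (Fin n)) (hw : ∀ i, |w i| ≤ r) : ‖meas B w‖ ≤ r * M := by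
  obtain ⟨y, hy, rfl⟩ : ∃ y : Fin n → ℝ, (∀ i, |y i| ≤ 1) ∧ w = r • WithLp.toLp 2 y := by
    rcases hr.eq_or_lt with rfl | hr
    · refine ⟨0, by simp, ?_⟩
      ext i
      simpa using abs_nonpos_iff.1 (hw i)
    · refine ⟨fun i => r⁻¹ * w i, fun i => ?_, ?_⟩
      · rw [abs_mul, abs_inv, abs_of_pos hr, inv_mul_le_iff₀ hr]
        simpa using hw i
      · ext i
        simp [hr.ne']
  rw [meas_smul, norm_smul, Real.norm_eq_abs, abs_of_nonneg hr]
  refine mul_le_mul_of_nonneg_left ?_ hr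
  -- A sublevel set of the convex map `y ↦ ‖By‖` contains the convex hull of the sign vectors, which
  -- is `[-1,1]^n`.
  have hconv : Convex ℝ {y : Fin n → ℝ | ‖meas B (WithLp.toLp 2 y)‖ ≤ M} := by
    have h1 : ConvexOn ℝ Set.univ fun y : Fin n → ℝ => ‖meas B (WithLp.toLp 2 y)‖ := by
      refine ⟨convex_univ, fun x _ y _ a b ha hb _ => ?_⟩
      have : meas B (WithLp.toLp 2 (a • x + b • y)) =
          a • meas B (WithLp.toLp 2 x) + b • meas B (WithLp.toLp 2 y) := by
        simp [meas, Matrix.mulVec_add, Matrix.mulVec_smul]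
      simp only [this]
      refine (norm_add_le _ _).trans_eq ?_
      simp [norm_smul, abs_of_nonneg ha, abs_of_nonneg hb]
    simpa using h1.convex_le M
  have hsub : Set.univ.pi (fun _ : Fin n => ({1, -1} : Set ℝ)) ⊆
      {y : Fin n → ℝ | ‖meas B (WithLp.toLp 2 y)‖ ≤ M} := by
    intro y hy
    classical
    have := hM fun i => decide (y i = 1)
    have e : (fun i => if (decide (y i = 1)) = true then (1 : ℝ) else -1) = y := by
      ext i
      rcases hy i trivial with h | h
      · simp [h]
      · rw [Set.mem_singleton_iff.1 h]; norm_num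
    rwa [e] at this
  apply convexHull_min hsub hconv
  rw [convexHull_pi]
  intro i _
  rw [convexHull_pair, segment_symm, segment_eq_Icc (by norm_num)]
  exact abs_le.1 (hy i)

end Meas

/-! ### A prefix computer for sparse vectors -/

section Computer

/-- Bit `t` of the output of the sparse decoder: the program is `1^k 0` followed by `k` blocks, each
made of the `m` bits of a position and the `m` bits of the value at this position. -/
def SparseBit (x : List Bool × ℕ × ℕ) (t : ℕ) : Prop :=
  ∃ e < x.1.idxOf false,
    (∀ j < x.2.2, x.1.getD (x.1.idxOf false + 1 + 2 * x.2.2 * e + j) false =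
      (t / x.2.2).testBit j) ∧
    x.1.getD (x.1.idxOf false + 1 + 2 * x.2.2 * e + x.2.2 + t % x.2.2) false = true

open Classical in
/-- The decoder of sparse vectors. -/
def sparseDecode (x : List Bool × ℕ × ℕ) : Option (List Bool) :=
  if x.1.length = x.1.idxOf false + 1 + 2 * x.2.2 * x.1.idxOf false then
    some ((List.range (x.2.1 * x.2.2)).map fun t => decide (SparseBit x t))
  else none

/-! ### Primitive recursiveness of the decoder -/

section Primrec

variable {α : Type*} [Primcodable α]

lemma primrec_two_pow : Primrec fun j : ℕ => 2 ^ j :=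
  (Primrec.nat_rec₁ 1 (Primrec.nat_mul.comp (Primrec.const 2) Primrec.snd).to₂).of_eq fun j => by
    induction j with
    | zero => rfl
    | succ j ih => simp only [ih]; ring

lemma primrec_testBit : Primrec₂ Nat.testBit :=
  (Primrec.eq.comp (Primrec.nat_mod.comp (Primrec.nat_div.comp Primrec.fst
    (primrec_two_pow.comp Primrec.snd)) (Primrec.const 2)) (Primrec.const 1)).decide.to₂.of_eq
    fun _ _ => (Nat.testBit_eq_decide_div_mod_eq).symm

lemma primrecPred_exists_lt {p : α → ℕ → Prop} (hp : PrimrecRel p) {f : α → ℕ} (hf : Primrec f) :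
    PrimrecPred fun a => ∃ x < f a, p a x :=
  ((PrimrecRel.exists_mem_list (R := fun x a => p a x)
    (hp.comp Primrec.snd Primrec.fst)).comp (Primrec.list_range.comp hf) Primrec.id).of_eq
    fun a => by simp

lemma primrecPred_forall_lt {p : α → ℕ → Prop} (hp : PrimrecRel p) {f : α → ℕ} (hf : Primrec f) :
    PrimrecPred fun a => ∀ x < f a, p a x :=
  ((PrimrecRel.forall_mem_list (R := fun x a => p a x)
    (hp.comp Primrec.snd Primrec.fst)).comp (Primrec.list_range.comp hf) Primrec.id).of_eq
    fun a => by simp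

open Primrec in
lemma primrecRel_sparseBit : PrimrecRel SparseBit := by
  have hidx : Primrec fun l : List Bool => l.idxOf false :=
    list_idxOf.comp (const false) Primrec.id
  have hoff : Primrec fun q : (List Bool × ℕ × ℕ) × ℕ =>
      q.1.1.idxOf false + 1 + 2 * q.1.2.2 * q.2 :=
    nat_add.comp (nat_add.comp (hidx.comp (fst.comp fst)) (const 1))
      (nat_mul.comp (nat_mul.comp (const 2) (snd.comp (snd.comp fst))) snd)
  have hpos : PrimrecPred fun q : ((List Bool × ℕ × ℕ) × ℕ) × ℕ => ∀ j < q.1.1.2.2,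
      q.1.1.1.getD (q.1.1.1.idxOf false + 1 + 2 * q.1.1.2.2 * q.2 + j) false =
        (q.1.2 / q.1.1.2.2).testBit j := by
    refine primrecPred_forall_lt ?_ (snd.comp (snd.comp (fst.comp fst)))
    unfold PrimrecRel
    refine Primrec.eq.comp ((list_getD false).comp (fst.comp (fst.comp (fst.comp fst)))
      (nat_add.comp (hoff.comp (Primrec.pair (fst.comp (fst.comp fst)) (snd.comp fst))) snd)) ?_
    exact primrec_testBit.comp (nat_div.comp (snd.comp (fst.comp fst))
      (snd.comp (snd.comp (fst.comp (fst.comp fst))))) snd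
  have hval : PrimrecPred fun q : ((List Bool × ℕ × ℕ) × ℕ) × ℕ =>
      q.1.1.1.getD (q.1.1.1.idxOf false + 1 + 2 * q.1.1.2.2 * q.2 + q.1.1.2.2 +
        q.1.2 % q.1.1.2.2) false = true := by
    have hm : Primrec fun q : ((List Bool × ℕ × ℕ) × ℕ) × ℕ => q.1.1.2.2 :=
      snd.comp (snd.comp (fst.comp fst))
    exact Primrec.eq.comp ((list_getD false).comp (fst.comp (fst.comp fst))
      (nat_add.comp (nat_add.comp (hoff.comp (Primrec.pair (fst.comp fst) snd)) hm)
        (nat_mod.comp (snd.comp fst) hm))) (const true)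
  exact primrecPred_exists_lt (PrimrecPred.primrecRel (hpos.and hval))
    (hidx.comp (fst.comp fst))

open Primrec in
lemma primrec_sparseDecode : Primrec sparseDecode := by
  classical
  have hidx : Primrec fun x : List Bool × ℕ × ℕ => x.1.idxOf false :=
    list_idxOf.comp (const false) fst
  have hm : Primrec fun x : List Bool × ℕ × ℕ => x.2.2 := snd.comp snd
  refine ite (Primrec.eq.comp (list_length.comp fst) (nat_add.comp (nat_add.comp hidx (const 1))
    (nat_mul.comp (nat_mul.comp (const 2) hm) hidx))) (option_some.comp ?_) (const none)
  exact list_map (list_range.comp (nat_mul.comp (fst.comp snd) hm)) primrecRel_sparseBit.decide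

end Primrec

/-- The prefix computer that decodes sparse vectors. -/
def sparseComputer : PrefixComputer where
  run x := (sparseDecode x : Part (List Bool))
  partrec := Computable.ofOption primrec_sparseDecode.to_comp
  prefixFree y p q hp hq hpq := by
    have h : ∀ p, (sparseDecode (p, y) : Part (List Bool)).Dom →
        p.length = p.idxOf false + 1 + 2 * y.2 * p.idxOf false := fun p h => by
      by_contra hne
      simp [sparseDecode, hne] at h
    have hp := h p hp
    have hq := h q hq
    -- The length equation forces a `false` in a halting program. An extension has the same first
    -- `false`, hence the same prescribed length.
    have hmem : false ∈ p := List.idxOf_lt_length_iff.1 (by omega)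
    obtain ⟨r, rfl⟩ := hpq
    rw [List.idxOf_append_of_mem hmem, List.length_append] at hq
    rw [List.length_eq_zero_iff.1 (show r.length = 0 by omega), List.append_nil]

/-- The program that encodes the positions `pos e` and the bits `val e`, for `e < k`. -/
def sparseEncode (m k : ℕ) (pos : ℕ → ℕ) (val : ℕ → ℕ → Bool) : List Bool :=
  List.replicate k true ++ false :: (List.range (2 * m * k)).map fun r =>
    if r % (2 * m) < m then (pos (r / (2 * m))).testBit (r % (2 * m))
    else val (r / (2 * m)) (r % (2 * m) - m)

/-! ### Correctness of the encoding -/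

section Encode

variable {m k : ℕ} {pos : ℕ → ℕ} {val : ℕ → ℕ → Bool}

lemma idxOf_sparseEncode : (sparseEncode m k pos val).idxOf false = k := by
  rw [sparseEncode, List.idxOf_append_of_notMem (by simp [List.mem_replicate])]
  simp

lemma length_sparseEncode : (sparseEncode m k pos val).length = k + 1 + 2 * m * k := by
  simp [sparseEncode]; ring

lemma getD_sparseEncode {e j : ℕ} (he : e < k) (hj : j < 2 * m) :
    (sparseEncode m k pos val).getD (k + 1 + 2 * m * e + j) false =
      if j < m then (pos e).testBit j else val e (j - m) := by
  have hlt : 2 * m * e + j < 2 * m * k := by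
    calc 2 * m * e + j < 2 * m * (e + 1) := by rw [mul_add]; omega
      _ ≤ 2 * m * k := Nat.mul_le_mul_left _ he
  have hmod : (2 * m * e + j) % (2 * m) = j := by
    rw [Nat.mul_add_mod, Nat.mod_eq_of_lt hj]
  have hdiv : (2 * m * e + j) / (2 * m) = e := by
    rw [Nat.mul_add_div (by omega), Nat.div_eq_of_lt hj, add_zero]
  rw [sparseEncode, List.getD_append_right _ _ _ _ (by simp; omega)]
  rw [List.length_replicate, show k + 1 + 2 * m * e + j - k = (2 * m * e + j) + 1 by omega,
    List.getD_cons_succ, List.getD_eq_getElem _ _ (by simpa using hlt)]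
  simp [hmod, hdiv]

lemma sparseBit_sparseEncode {n t : ℕ} (hm : 0 < m) (ht : t / m < 2 ^ m)
    (hpos : ∀ e < k, pos e < 2 ^ m) :
    SparseBit (sparseEncode m k pos val, n, m) t ↔
      ∃ e < k, pos e = t / m ∧ val e (t % m) = true := by
  simp only [SparseBit, idxOf_sparseEncode]
  refine exists_congr fun e => and_congr_right fun he => and_congr ?_ ?_
  · constructor
    · intro h
      refine Nat.eq_of_testBit_eq fun j => ?_
      by_cases hj : j < m
      · rw [← h j hj, getD_sparseEncode he (by omega), if_pos hj]
      -- The program stores only `m` bits of a position; both numbers are below `2^m`, so their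
      -- higher bits vanish.
      · have h2 : 2 ^ m ≤ 2 ^ j := Nat.pow_le_pow_right (by norm_num) (by omega)
        rw [Nat.testBit_lt_two_pow ((hpos e he).trans_le h2),
          Nat.testBit_lt_two_pow (ht.trans_le h2)]
    · intro h j hj
      rw [getD_sparseEncode he (by omega), if_pos hj, h]
  · have := Nat.mod_lt t hm
    rw [add_assoc (k + 1 + 2 * m * e), getD_sparseEncode he (by omega), if_neg (by omega)]
    simp

open Classical in
lemma mem_run_sparseEncode {n : ℕ} (hm : 0 < m) (hn : n ≤ 2 ^ m) (hpos : ∀ e < k, pos e < 2 ^ m) :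
    ((List.range (n * m)).map fun t => decide (∃ e < k, pos e = t / m ∧ val e (t % m) = true)) ∈
      sparseComputer.run (sparseEncode m k pos val, n, m) := by
  simp only [sparseComputer, sparseDecode, length_sparseEncode, idxOf_sparseEncode, if_true,
    Part.coe_some, Part.mem_some_iff]
  refine List.map_congr_left fun t ht => ?_
  have : t / m < n := Nat.div_lt_of_lt_mul (by rw [mul_comm]; exact List.mem_range.1 ht)
  rw [decide_eq_decide]
  exact (sparseBit_sparseEncode hm (this.trans_le hn) hpos).symm

end Encode

/-! ### Binary expansions and quantization -/

lemma binReal_mem_Icc (s : List Bool) : binReal s ∈ Set.Icc (0 : ℝ) 1 := by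
  induction s with
  | nil => simp [binReal]
  | cons b s ih =>
    obtain ⟨h0, h1⟩ := ih
    cases b <;> constructor <;> simp [binReal] <;> linarith

lemma binReal_replicate_false (m : ℕ) : binReal (List.replicate m false) = 0 := by
  induction m with
  | zero => rfl
  | succ m ih => simp [List.replicate_succ, binReal, ih]

/-- Bisection: the first bit selects a half of the interval, and doubling maps that half back to
`[0,1]`. The closed endpoint `1` is allowed because the error bound is not strict. -/
lemma exists_binReal_near (m : ℕ) {y : ℝ} (hy : y ∈ Set.Icc (0 : ℝ) 1) :
    ∃ s : List Bool, s.length = m ∧ |y - binReal s| ≤ (2 : ℝ)⁻¹ ^ m := by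
  induction m generalizing y with
  | zero => exact ⟨[], rfl, by simpa [binReal, abs_of_nonneg hy.1] using hy.2⟩
  | succ m ih =>
    obtain ⟨h0, h1⟩ := hy
    rcases le_total y (1 / 2) with h | h
    · obtain ⟨s, hs, hd⟩ := ih (y := 2 * y) ⟨by linarith, by linarith⟩
      refine ⟨false :: s, by simp [hs], ?_⟩
      have : y - binReal (false :: s) = (2 * y - binReal s) * 2⁻¹ := by simp [binReal]; ring
      rw [this, abs_mul, pow_succ, abs_of_nonneg (by norm_num : (0 : ℝ) ≤ 2⁻¹)]
      gcongr
    · obtain ⟨s, hs, hd⟩ := ih (y := 2 * y - 1) ⟨by linarith, by linarith⟩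
      refine ⟨true :: s, by simp [hs], ?_⟩
      have : y - binReal (true :: s) = (2 * y - 1 - binReal s) * 2⁻¹ := by simp [binReal]; ring
      rw [this, abs_mul, pow_succ, abs_of_nonneg (by norm_num : (0 : ℝ) ≤ 2⁻¹)]
      gcongr

lemma drop_take_map_range {α : Type*} (f : ℕ → α) {n m i : ℕ} (hi : i < n) :
    ((((List.range (n * m)).map f).drop (i * m)).take m) =
      (List.range m).map fun j => f (i * m + j) := by
  have hle : (i + 1) * m ≤ n * m := Nat.mul_le_mul_right _ hi
  rw [add_mul, one_mul] at hle
  apply List.ext_getElem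
  · simp; omega
  · intro j h1 h2
    simp

/-- A vector with few nonzero components is within `2⁻ᵐ` of a vector of small complexity. -/
lemma exists_condK_sparseComputer_le {n m : ℕ} (hm : 0 < m) (hn : n ≤ 2 ^ m)
    (y : EuclideanSpace ℝ (Fin n)) (hy : y ∈ unitCube n) (T : Finset (Fin n))
    (hT : ∀ i ∉ T, y i = 0) :
    ∃ u ∈ unitCube n, (∀ i, |y i - u i| ≤ (2 : ℝ)⁻¹ ^ m) ∧
      ∃ s, Represents s u ∧
        condK sparseComputer s (n, m) ≤ ((T.card + 1 + 2 * m * T.card : ℕ) : ℕ∞) := by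
  classical
  choose bits hbits hnear using fun i => exists_binReal_near m (hy i)
  set pos : ℕ → ℕ := fun e => if h : e < T.card then ((T.equivFin.symm ⟨e, h⟩ : Fin n) : ℕ) else 0
    with hposdef
  set val : ℕ → ℕ → Bool := fun e j =>
    if h : e < T.card then (bits (T.equivFin.symm ⟨e, h⟩)).getD j false else false with hvaldef
  have hpos : ∀ e < T.card, pos e < 2 ^ m := fun e he => by
    simp only [hposdef, he, dif_pos]
    exact (Fin.is_lt _).trans_le hn
  set f : ℕ → Bool := fun t => decide (∃ e < T.card, pos e = t / m ∧ val e (t % m) = true) with hf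
  set u : EuclideanSpace ℝ (Fin n) :=
    WithLp.toLp 2 fun i => binReal ((((List.range (n * m)).map f).drop (i * m)).take m) with hu
  -- Output bit `i * m + j` is bit `j` of component `i`; a position absent from the program decodes
  -- to a zero block.
  have hblock : ∀ i : Fin n, (((List.range (n * m)).map f).drop (i * m)).take m =
      if i ∈ T then bits i else List.replicate m false := fun i => by
    rw [drop_take_map_range f i.2]
    have hfij : ∀ j < m, f (i * m + j) = if i ∈ T then (bits i).getD j false else false := by
      intro j hj
      have h1 : (i * m + j) / m = i := by
        rw [mul_comm, Nat.mul_add_div hm, Nat.div_eq_of_lt hj, add_zero]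
      have h2 : (i * m + j) % m = j := by rw [mul_comm, Nat.mul_add_mod, Nat.mod_eq_of_lt hj]
      simp only [hf, h1, h2]
      split_ifs with hi
      · rw [Bool.eq_iff_iff, decide_eq_true_iff]
        constructor
        · rintro ⟨e, he, hp, hv⟩
          simp only [hposdef, hvaldef, he, dif_pos] at hp hv
          rwa [Fin.ext hp] at hv
        · intro hv
          refine ⟨T.equivFin ⟨i, hi⟩, Fin.is_lt _, ?_, ?_⟩
          · simp [hposdef]
          · simpa [hvaldef] using hv
      · rw [decide_eq_false_iff_not]
        rintro ⟨e, he, hp, -⟩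
        simp only [hposdef, he, dif_pos] at hp
        exact hi (Fin.ext hp ▸ (T.equivFin.symm ⟨e, he⟩).2)
    apply List.ext_getElem
    · split_ifs <;> simp [hbits]
    · intro j h1 h2
      have hj : j < m := by simpa using h1
      simp only [List.getElem_map, List.getElem_range, hfij j hj]
      split_ifs with hi
      · rw [List.getD_eq_getElem _ _ (by rw [hbits]; exact hj)]
      · simp
  refine ⟨u, fun i => binReal_mem_Icc _, fun i => ?_, (List.range (n * m)).map f,
    ⟨m, hm, by simp, fun i => rfl⟩, ?_⟩
  · simp only [hu, hblock i]
    split_ifs with hi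
    · exact hnear i
    · rw [binReal_replicate_false, hT i hi]
      simp
  · refine (iInf₂_le (sparseEncode m T.card pos val) (mem_run_sparseEncode hm hn hpos)).trans ?_
    rw [length_sparseEncode]

end Computer

/-! ### Counting, compactness and sparse approximation -/

section LowComplexity

/-- In `ℕ∞`, `a ≤ L` is the same as `a < L + 1`, and a strict bound on an infimum is witnessed. This
turns every complexity bound into an actual program. -/
lemma iInf_le_natCast_iff {ι : Sort*} (f : ι → ℕ∞) (L : ℕ) :
    ⨅ i, f i ≤ (L : ℕ∞) ↔ ∃ i, f i ≤ (L : ℕ∞) := by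
  have h : ∀ a : ℕ∞, a ≤ (L : ℕ∞) ↔ a < (L : ℕ∞) + 1 := fun a =>
    (ENat.lt_add_one_iff (ENat.natCast_ne_top L)).symm
  simp_rw [h, iInf_lt_iff]

/-- The vectors of complexity at most `L`. -/
def simpleVecs (U : PrefixComputer) (m n L : ℕ) : Set (EuclideanSpace ℝ (Fin n)) :=
  {u | ∃ s, Represents s u ∧ condK U s (n, m) ≤ (L : ℕ∞)}

lemma vecK_le_natCast_iff {U : PrefixComputer} {m n L : ℕ} {u : EuclideanSpace ℝ (Fin n)} :
    vecK U m u ≤ (L : ℕ∞) ↔ u ∈ simpleVecs U m n L := by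
  simp only [vecK, iInf_le_natCast_iff, simpleVecs, Set.mem_ofPred_eq, exists_prop]

lemma condK_le_natCast_iff {U : PrefixComputer} {s : List Bool} {y : ℕ × ℕ} {L : ℕ} :
    condK U s y ≤ (L : ℕ∞) ↔ ∃ p, s ∈ U.run (p, y) ∧ p.length ≤ L := by
  simp only [condK, iInf_le_natCast_iff, exists_prop, Nat.cast_le]

lemma natCast_le_ofReal_iff_floor {a : ℕ∞} {r : ℝ} (hr : 0 ≤ r) :
    (a : ℝ≥0∞) ≤ ENNReal.ofReal r ↔ a ≤ (⌊r⌋₊ : ℕ∞) := by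
  induction a using ENat.recTopCoe with
  | top => simp
  | coe k =>
    rw [ENat.toENNReal_coe, Nat.cast_le, Nat.le_floor_iff hr, ← ENNReal.ofReal_natCast,
      ENNReal.ofReal_le_ofReal_iff hr]

lemma mem_lowComplexity_iff {U : PrefixComputer} {m n : ℕ} {κ : ℝ} (hκ : 0 ≤ κ)
    {x : EuclideanSpace ℝ (Fin n)} :
    x ∈ lowComplexity U m κ n ↔ x ∈ unitCube n ∧ ∃ u ∈ unitCube n,
      (∀ i, |x i - u i| ≤ (2 : ℝ)⁻¹ ^ m) ∧ u ∈ simpleVecs U m n ⌊κ * m⌋₊ := by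
  simp only [lowComplexity, Set.mem_ofPred_eq, natCast_le_ofReal_iff_floor
    (mul_nonneg hκ (Nat.cast_nonneg m)), resK, iInf_le_natCast_iff, vecK_le_natCast_iff,
    exists_prop]

/-- The length of the string determines the common block length, hence the blocks. -/
lemma Represents.unique {n : ℕ} {s : List Bool} {u v : EuclideanSpace ℝ (Fin n)}
    (hu : Represents s u) (hv : Represents s v) : u = v := by
  obtain ⟨ℓ, -, hl, hu⟩ := hu
  obtain ⟨ℓ', -, hl', hv⟩ := hv
  ext i
  have : ℓ = ℓ' := Nat.eq_of_mul_eq_mul_left (Fin.pos i) (hl.symm.trans hl')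
  rw [hu, hv, this]

lemma exists_finset_list_bool (L : ℕ) :
    ∃ F : Finset (List Bool), F.card ≤ 2 ^ (L + 1) ∧ ∀ p : List Bool, p.length ≤ L → p ∈ F := by
  classical
  refine ⟨(Finset.range (L + 1)).biUnion fun l =>
    Finset.univ.image fun f : Fin l → Bool => List.ofFn f, ?_, fun p hp => ?_⟩
  · refine Finset.card_biUnion_le.trans ?_
    calc _ ≤ ∑ l ∈ Finset.range (L + 1), 2 ^ l := Finset.sum_le_sum fun l _ =>
          Finset.card_image_le.trans (by simp)
      _ ≤ 2 ^ (L + 1) := by rw [Nat.geomSum_eq le_rfl]; simp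
  · simp only [Finset.mem_biUnion, Finset.mem_range, Finset.mem_image, Finset.mem_univ, true_and]
    exact ⟨p.length, by omega, p.get, List.ofFn_get p⟩

/-- A program determines its output and the output determines the vector, so choosing a short
program for each vector is injective. -/
lemma exists_finset_simpleVecs (U : PrefixComputer) (m n L : ℕ) :
    ∃ V : Finset (EuclideanSpace ℝ (Fin n)), V.card ≤ 2 ^ (L + 1) ∧ ↑V = simpleVecs U m n L := by
  classical
  obtain ⟨F, hF, hmem⟩ := exists_finset_list_bool L
  have hprog : ∀ u ∈ simpleVecs U m n L, ∃ p ∈ F, ∃ s, Represents s u ∧ s ∈ U.run (p, n, m) := by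
    rintro u ⟨s, hs, hK⟩
    obtain ⟨p, hp, hl⟩ := condK_le_natCast_iff.1 hK
    exact ⟨p, hmem p hl, s, hs, hp⟩
  choose! g hg using hprog
  have hinj : Set.InjOn g (simpleVecs U m n L) := fun u hu v hv huv => by
    obtain ⟨-, s, hs, hps⟩ := hg u hu
    obtain ⟨-, s', hs', hps'⟩ := hg v hv
    rw [huv] at hps
    rw [Part.mem_unique hps hps'] at hs
    exact hs.unique hs'
  have hmaps : Set.MapsTo g (simpleVecs U m n L) F := fun u hu => (hg u hu).1
  have hfin : (simpleVecs U m n L).Finite := F.finite_toSet.of_injOn hmaps hinj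
  refine ⟨hfin.toFinset, (Finset.card_le_card_of_injOn g ?_ ?_).trans hF, by simp⟩
  · simpa using hmaps
  · simpa using hinj

lemma isCompact_unitCube (n : ℕ) : IsCompact (unitCube n) := by
  have h : unitCube n = (WithLp.toLp 2) '' (Set.univ.pi fun _ : Fin n => Set.Icc (0 : ℝ) 1) := by
    ext x
    constructor
    · exact fun hx => ⟨x.ofLp, fun i _ => hx i, rfl⟩
    · rintro ⟨y, hy, rfl⟩
      exact fun i => hy i trivial
  rw [h]
  exact (isCompact_univ_pi fun _ => isCompact_Icc).image (by fun_prop)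

/-- The set is the cube intersected with a finite union of closed sup-norm balls. Compactness is
what makes the minimum attained for every matrix. -/
lemma isCompact_lowComplexity (U : PrefixComputer) (m n : ℕ) {κ : ℝ} (hκ : 0 ≤ κ) :
    IsCompact (lowComplexity U m κ n) := by
  obtain ⟨V, -, hV⟩ := exists_finset_simpleVecs U m n ⌊κ * m⌋₊
  have h : lowComplexity U m κ n = unitCube n ∩ ⋃ u ∈ (V : Set _) ∩ unitCube n,
      {x | ∀ i, |x i - u i| ≤ (2 : ℝ)⁻¹ ^ m} := by
    ext x
    rw [mem_lowComplexity_iff hκ, hV]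
    simp only [Set.mem_inter_iff, Set.mem_iUnion, exists_prop, Set.mem_ofPred_eq]
    refine and_congr_right fun _ => exists_congr fun u => ?_
    tauto
  rw [h]
  refine (isCompact_unitCube n).inter_right
    ((V.finite_toSet.inter_of_left _).isClosed_biUnion fun u _ => ?_)
  have : {x : EuclideanSpace ℝ (Fin n) | ∀ i, |x i - u i| ≤ (2 : ℝ)⁻¹ ^ m} =
      ⋂ i, {x : EuclideanSpace ℝ (Fin n) | |x i - u i| ≤ (2 : ℝ)⁻¹ ^ m} := by
    ext; simp
  rw [this]
  exact isClosed_iInter fun i => isClosed_le (by fun_prop) continuous_const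

lemma exists_isLLSSolution (U : PrefixComputer) {m n d : ℕ} {κ : ℝ} (hκ : 0 ≤ κ)
    (hne : (lowComplexity U m κ n).Nonempty) (A : Matrix (Fin d) (Fin n) ℝ)
    (y : EuclideanSpace ℝ (Fin d)) : ∃ xhat, IsLLSSolution U m κ A y xhat := by
  have hcont : Continuous fun x : EuclideanSpace ℝ (Fin n) => ‖y - meas A x‖ ^ 2 := by
    unfold meas
    fun_prop
  obtain ⟨x, hx, hmin⟩ := (isCompact_lowComplexity U m n hκ).exists_isMinOn hne hcont.continuousOn
  exact ⟨x, hx, fun z hz => hmin hz⟩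

/-- Every vector of the `ℓ_p` ball is close to a vector with few nonzero components. -/
lemma exists_sparse_approx {n : ℕ} (hn : 0 < n) {p : ℝ} (hp0 : 0 < p) (hp1 : p < 1)
    {x : EuclideanSpace ℝ (Fin n)} (hx : x ∈ unitCube n) (hxp : x ∈ lpBall p n) :
    ∃ y ∈ unitCube n, ∃ T : Finset (Fin n), (∀ i ∉ T, y i = 0) ∧
      (T.card : ℝ) ≤ (n : ℝ) ^ (p / 2) ∧ ‖x - y‖ ^ 2 ≤ (n : ℝ) ^ (p / 2 - 1) := by
  classical
  have hn' : (0 : ℝ) < n := Nat.cast_pos.2 hn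
  have hsum : ∑ i, |x i| ^ p ≤ 1 := by
    have h : (∑ i, |x i| ^ p) ^ (1 / p) ≤ 1 := hxp
    by_contra! hlt
    exact absurd h (not_le.2 (Real.one_lt_rpow hlt (by positivity)))
  -- Threshold: at most `t^(-p) = n^(p/2)` entries reach `t`, and each smaller one satisfies `x² ≤
  -- t^(2-p) |x|^p`.
  set t : ℝ := (n : ℝ) ^ (-(1 / 2) : ℝ) with ht
  have ht0 : 0 < t := by positivity
  have hnonneg : ∀ i, 0 ≤ |x i| ^ p := fun i => by positivity
  set T : Finset (Fin n) := {i | t ≤ |x i|} with hT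
  refine ⟨WithLp.toLp 2 fun i => if i ∈ T then x i else 0, fun i => ?_, T, fun i hi => by simp [hi],
    ?_, ?_⟩
  · by_cases hi : i ∈ T
    · simpa [hi] using hx i
    · simp [hi]
  · have h1 : (T.card : ℝ) * t ^ p ≤ 1 := by
      rw [← nsmul_eq_mul]
      refine (Finset.card_nsmul_le_sum T (fun i => |x i| ^ p) _ fun i hi => ?_).trans
        ((Finset.sum_le_univ_sum_of_nonneg hnonneg).trans hsum)
      exact Real.rpow_le_rpow ht0.le (Finset.mem_filter.1 hi).2 hp0.le
    have h2 : t ^ p = ((n : ℝ) ^ (p / 2))⁻¹ := by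
      rw [ht, ← Real.rpow_mul hn'.le, ← Real.rpow_neg hn'.le]; ring_nf
    rwa [h2, ← div_eq_mul_inv, div_le_one (by positivity)] at h1
  · have h2 : t ^ (2 - p) = (n : ℝ) ^ (p / 2 - 1) := by
      rw [ht, ← Real.rpow_mul hn'.le]; ring_nf
    rw [EuclideanSpace.real_norm_sq_eq, ← h2]
    calc _ ≤ ∑ i, t ^ (2 - p) * |x i| ^ p := Finset.sum_le_sum fun i _ => ?_
      _ = t ^ (2 - p) * ∑ i, |x i| ^ p := by rw [Finset.mul_sum]
      _ ≤ t ^ (2 - p) := mul_le_of_le_one_right (by positivity) hsum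
    by_cases hi : i ∈ T
    · simp only [PiLp.sub_apply, hi, if_true, sub_self, zero_pow two_ne_zero]
      positivity
    · have hlt : |x i| < t := by simpa [hT] using hi
      simp only [PiLp.sub_apply, hi, if_false, sub_zero]
      rcases (abs_nonneg (x i)).eq_or_lt with h0 | h0
      · rw [abs_eq_zero.1 h0.symm, zero_pow two_ne_zero]; positivity
      · calc x i ^ 2 = |x i| ^ (2 - p) * |x i| ^ p := by
              rw [← Real.rpow_add h0, sub_add_cancel, Real.rpow_two, sq_abs]
          _ ≤ _ := by gcongr; linarith

end LowComplexity

/-! ### Error of the least squares solution -/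

section Recovery

variable {d n : ℕ}

lemma norm_le_of_abs_le {w : EuclideanSpace ℝ (Fin n)} {r : ℝ} (hr : 0 ≤ r)
    (hw : ∀ i, |w i| ≤ r) : ‖w‖ ≤ √n * r := by
  rw [EuclideanSpace.norm_eq, Real.sqrt_le_left (by positivity), mul_pow,
    Real.sq_sqrt (Nat.cast_nonneg n)]
  refine (Finset.sum_le_card_nsmul Finset.univ _ (r ^ 2) fun i _ => ?_).trans_eq (by simp)
  rw [Real.norm_eq_abs]
  exact pow_le_pow_left₀ (abs_nonneg _) (hw i) 2

/-- The error of a solution of low-complexity least squares, on the event that the matrix is well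
behaved on the relevant vectors. -/
lemma IsLLSSolution.norm_sub_le {U : PrefixComputer} {m : ℕ} {κ : ℝ} (hκ : 0 ≤ κ) (hd : 0 < d)
    {B : Matrix (Fin d) (Fin n) ℝ} {xo xhat y : EuclideanSpace ℝ (Fin n)}
    (hsol : IsLLSSolution U m κ B (meas B xo) xhat) (hy : y ∈ lowComplexity U m κ n) {M N : ℝ}
    (hM : ∀ s : Fin n → Bool, ‖meas B (WithLp.toLp 2 fun i => if s i then 1 else -1)‖ ≤ M)
    (hN : ‖meas B (xo - y)‖ ≤ N)
    (hlow : ∀ u ∈ simpleVecs U m n ⌊κ * m⌋₊,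
      d / tailRatio * ‖xo - u‖ ^ 2 ≤ ‖meas B (xo - u)‖ ^ 2) :
    ‖xo - xhat‖ ≤ √(tailRatio / d) * ((2 : ℝ)⁻¹ ^ m * M + N) + √n * (2 : ℝ)⁻¹ ^ m := by
  have hτ := tailRatio_pos
  have hd' : (0 : ℝ) < d := Nat.cast_pos.2 hd
  obtain ⟨hmem, hmin⟩ := hsol
  obtain ⟨-, u, -, hclose, hu⟩ := (mem_lowComplexity_iff hκ).1 hmem
  -- Minimality of `xhat` against the competitor `y`.
  have h1 : ‖meas B (xo - xhat)‖ ≤ N := by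
    have := hmin y hy
    rw [← meas_sub, ← meas_sub] at this
    exact (pow_le_pow_iff_left₀ (norm_nonneg _) (norm_nonneg _) two_ne_zero).1 this |>.trans hN
  have h2 : ‖meas B (xhat - u)‖ ≤ (2 : ℝ)⁻¹ ^ m * M :=
    norm_meas_le_of_signs B (by positivity) hM _ hclose
  have h3 : ‖meas B (xo - u)‖ ≤ (2 : ℝ)⁻¹ ^ m * M + N := by
    have : meas B (xo - u) = meas B (xhat - u) + meas B (xo - xhat) := by
      simp only [meas_sub]; abel
    rw [this]
    exact (norm_add_le _ _).trans (add_le_add h2 h1)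
  have h4 : ‖xo - u‖ ≤ √(tailRatio / d) * ((2 : ℝ)⁻¹ ^ m * M + N) := by
    have h5 : ‖xo - u‖ ^ 2 ≤ tailRatio / d * ‖meas B (xo - u)‖ ^ 2 := by
      calc ‖xo - u‖ ^ 2 = tailRatio / d * (d / tailRatio * ‖xo - u‖ ^ 2) := by field_simp
        _ ≤ _ := mul_le_mul_of_nonneg_left (hlow u hu) (by positivity)
    have h6 : ‖xo - u‖ ≤ √(tailRatio / d) * ‖meas B (xo - u)‖ := by
      have := Real.le_sqrt_of_sq_le h5
      rwa [Real.sqrt_mul (by positivity), Real.sqrt_sq (norm_nonneg _)] at this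
    exact h6.trans (mul_le_mul_of_nonneg_left h3 (Real.sqrt_nonneg _))
  have h7 : ‖u - xhat‖ ≤ √n * (2 : ℝ)⁻¹ ^ m := by
    rw [norm_sub_rev]
    exact norm_le_of_abs_le (by positivity) hclose
  calc ‖xo - xhat‖ = ‖(xo - u) + (u - xhat)‖ := by congr 1; abel
    _ ≤ _ := (norm_add_le _ _).trans (add_le_add h4 h7)

lemma normSq_signs (s : Fin n → Bool) :
    ‖(WithLp.toLp 2 fun i => if s i then (1 : ℝ) else -1 : EuclideanSpace ℝ (Fin n))‖ ^ 2 = n := by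
  rw [EuclideanSpace.real_norm_sq_eq]
  have : ∀ i, (if s i then (1 : ℝ) else -1) ^ 2 = 1 := fun i => by split_ifs <;> norm_num
  simp [this]

/-- Low-complexity least squares with a Gaussian matrix: the error bound in terms of the distance to
a vector of low complexity. -/
lemma measure_error_le {Ω : Type*} [MeasurableSpace Ω] {P : Measure Ω} [IsProbabilityMeasure P]
    {A : Ω → Matrix (Fin d) (Fin n) ℝ} (hA : IsStdGaussianMatrix P A) {U : PrefixComputer} {m : ℕ}
    {κ : ℝ} (hκ : 0 ≤ κ) (hd : 0 < d) (hdn : d ≤ n)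
    (hcard : (2 : ℝ) ^ (⌊κ * m⌋₊ + 1) ≤ Real.exp (2 * d))
    {xo y : EuclideanSpace ℝ (Fin n)} (hy : y ∈ lowComplexity U m κ n)
    {xhat : Ω → EuclideanSpace ℝ (Fin n)}
    (hsol : ∀ᵐ ω ∂P, IsLLSSolution U m κ (A ω) (meas (A ω) xo) (xhat ω)) {ε : ℝ}
    (hε : √(tailRatio / d) * ((2 : ℝ)⁻¹ ^ m * √(12 * n * n) + √(12 * d) * ‖xo - y‖) +
      √n * (2 : ℝ)⁻¹ ^ m ≤ ε) :
    P {ω | ε < ‖xo - xhat ω‖} ≤ ENNReal.ofReal (3 * Real.exp (-d)) := by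
  obtain ⟨V, hV, hVeq⟩ := exists_finset_simpleVecs U m n ⌊κ * m⌋₊
  have hdn' : (d : ℝ) ≤ n := Nat.cast_le.2 hdn
  -- Bad events: `A` too large on a sign vector, too large on `xo - y`, or too small on `xo - u` for
  -- some simple `u`. `V` does not depend on `ω`, although the `u` near `xhat ω` does.
  set E₁ : Set Ω := ⋃ s ∈ (Finset.univ : Finset (Fin n → Bool)),
    {ω | 12 * (n : ℝ) * ‖(WithLp.toLp 2 fun i => if s i then (1 : ℝ) else -1 :
      EuclideanSpace ℝ (Fin n))‖ ^ 2 <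
        ‖meas (A ω) (WithLp.toLp 2 fun i => if s i then (1 : ℝ) else -1)‖ ^ 2} with hE₁
  set E₂ : Set Ω := {ω | 12 * (d : ℝ) * ‖xo - y‖ ^ 2 < ‖meas (A ω) (xo - y)‖ ^ 2} with hE₂
  set E₃ : Set Ω := ⋃ u ∈ V,
    {ω | ‖meas (A ω) (xo - u)‖ ^ 2 < d / tailRatio * ‖xo - u‖ ^ 2} with hE₃
  have hP₁ : P E₁ ≤ ENNReal.ofReal (Real.exp (-d)) := by
    refine (measure_biUnion_finset_le _ _).trans
      ((Finset.sum_le_sum fun s _ => hA.meas_normSq_ge _ _).trans ?_)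
    rw [Finset.sum_const, nsmul_eq_mul, ← ENNReal.ofReal_natCast,
      ← ENNReal.ofReal_mul (Nat.cast_nonneg _)]
    refine ENNReal.ofReal_le_ofReal ?_
    have h2 : (2 : ℝ) ^ n ≤ Real.exp n := by
      rw [← Real.exp_one_pow]
      exact pow_le_pow_left₀ (by norm_num) (by linarith [Real.add_one_le_exp (1 : ℝ)]) n
    simp only [Finset.card_univ, Fintype.card_pi, Fintype.card_bool, Finset.prod_const,
      Fintype.card_fin, Nat.cast_pow, Nat.cast_ofNat]
    refine (mul_le_mul_of_nonneg_right h2 (Real.exp_pos _).le).trans ?_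
    -- The exponent is `n - 3n + d/2`, at most `-d` because `d ≤ n`.
    rw [← Real.exp_add]
    exact Real.exp_le_exp.2 (by linarith)
  have hP₂ : P E₂ ≤ ENNReal.ofReal (Real.exp (-d)) := by
    refine (hA.meas_normSq_ge _ _).trans (ENNReal.ofReal_le_ofReal (Real.exp_le_exp.2 ?_))
    linarith [Nat.cast_nonneg (α := ℝ) d]
  have hP₃ : P E₃ ≤ ENNReal.ofReal (Real.exp (-d)) := by
    refine (measure_biUnion_finset_le _ _).trans
      ((Finset.sum_le_sum fun s _ => hA.meas_normSq_le _).trans ?_)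
    rw [Finset.sum_const, nsmul_eq_mul, ← ENNReal.ofReal_natCast,
      ← ENNReal.ofReal_mul (Nat.cast_nonneg _)]
    refine ENNReal.ofReal_le_ofReal ?_
    have h2 : (V.card : ℝ) ≤ Real.exp (2 * d) := by
      refine le_trans ?_ hcard
      exact_mod_cast hV
    refine (mul_le_mul_of_nonneg_right h2 (Real.exp_pos _).le).trans ?_
    rw [← Real.exp_add]
    exact Real.exp_le_exp.2 (by linarith)
  -- Almost-everywhere inclusion suffices, and no measurability of `xhat` enters.
  have hsub : {ω | ε < ‖xo - xhat ω‖} ≤ᵐ[P] (E₁ ∪ E₂ ∪ E₃ : Set Ω) := by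
    filter_upwards [hsol] with ω hω hlt
    by_contra hnot
    have hnot' : ω ∉ E₁ ∪ E₂ ∪ E₃ := hnot
    rw [Set.mem_union, Set.mem_union, not_or, not_or] at hnot'
    obtain ⟨⟨h1, h2⟩, h3⟩ := hnot'
    simp only [hE₁, hE₂, hE₃, Set.mem_iUnion, Set.mem_ofPred_eq, not_exists, not_lt,
      Finset.mem_univ, true_implies, normSq_signs] at h1 h2 h3
    refine absurd ?_ (not_le.2 hlt)
    refine (hω.norm_sub_le hκ hd hy (fun s => Real.le_sqrt_of_sq_le (h1 s)) ?_ fun u hu =>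
      h3 u (by rw [← Finset.mem_coe, hVeq]; exact hu)).trans hε
    have := Real.le_sqrt_of_sq_le h2
    rwa [Real.sqrt_mul (by positivity), Real.sqrt_sq (norm_nonneg _)] at this
  refine (measure_mono_ae hsub).trans ?_
  refine (measure_union_le _ _).trans ((add_le_add ((measure_union_le _ _).trans
    (add_le_add hP₁ hP₂)) hP₃).trans_eq ?_)
  rw [← ENNReal.ofReal_add (by positivity) (by positivity),
    ← ENNReal.ofReal_add (by positivity) (by positivity)]
  ring_nf

end Recovery

/-! ### Comparison of parameters for large `n` -/

section Asymptotics

lemma eventually_rpow_mul_log_le {q : ℝ} (hq : q < 1) {C : ℝ} (hC : 0 < C) :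
    ∀ᶠ n : ℕ in atTop, C * ((n : ℝ) ^ q * Real.log n) ≤ n := by
  have h := ((isLittleO_log_rpow_atTop (r := 1 - q) (by linarith)).def
    (inv_pos.2 hC)).natCast_atTop
  filter_upwards [h, eventually_gt_atTop 0] with n hn hn0
  have hn' : (0 : ℝ) < n := Nat.cast_pos.2 hn0
  rw [Real.norm_eq_abs, Real.norm_eq_abs, abs_of_nonneg (by positivity : (0 : ℝ) ≤ (n : ℝ) ^ (1 - q))]
    at hn
  have h1 : Real.log n ≤ C⁻¹ * (n : ℝ) ^ (1 - q) := (le_abs_self _).trans hn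
  calc C * ((n : ℝ) ^ q * Real.log n) ≤ C * ((n : ℝ) ^ q * (C⁻¹ * (n : ℝ) ^ (1 - q))) := by gcongr
    _ = (n : ℝ) ^ q * (n : ℝ) ^ (1 - q) := by field_simp
    _ = n := by rw [← Real.rpow_add hn']; simp

/-- Both bases satisfy `1/2 ≤ log b ≤ 1`, so the two choices of logarithm are treated together. -/
lemma log_le_logb_le {b : ℝ} (hb : b = 2 ∨ b = Real.exp 1) {x : ℝ} (hx : 0 ≤ Real.log x) :
    Real.log x ≤ Real.logb b x ∧ Real.logb b x ≤ 2 * Real.log x := by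
  have hlb : 1 / 2 ≤ Real.log b ∧ Real.log b ≤ 1 := by
    rcases hb with rfl | rfl
    · exact ⟨by linarith [Real.log_two_gt_d9], by linarith [Real.log_two_lt_d9]⟩
    · simp; norm_num
  rw [Real.logb]
  constructor
  · rw [le_div_iff₀ (by linarith)]
    nlinarith
  · rw [div_le_iff₀ (by linarith)]
    nlinarith

lemma le_two_pow_ceil_logb {n : ℕ} (hn : 0 < n) : n ≤ 2 ^ ⌈Real.logb 2 n⌉₊ := by
  have h : (n : ℝ) ≤ (2 : ℝ) ^ ((⌈Real.logb 2 n⌉₊ : ℕ) : ℝ) := by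
    rw [← Real.logb_le_iff_le_rpow (by norm_num) (Nat.cast_pos.2 hn)]
    exact Nat.le_ceil _
  rw [Real.rpow_natCast] at h
  exact_mod_cast h

/-- The sum of the error terms is eventually below the required accuracy. -/
lemma error_terms_le {n d m : ℕ} {N l δ : ℝ} (hn : 0 < n) (hnm : n ≤ 2 ^ m) (hN : 0 < N) (hl : 0 < l)
    (hd : N * l ≤ d) (hδ : δ ^ 2 ≤ N / n) (h1 : 4 * tailRatio ≤ N)
    (h2 : 3 * tailRatio * (N * l) ≤ n) (h3 : l ≤ n) :
    √(tailRatio / d) * ((2 : ℝ)⁻¹ ^ m * √(12 * n * n) + √(12 * d) * δ) +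
      √n * (2 : ℝ)⁻¹ ^ m ≤ 7 / √l := by
  have hτ := tailRatio_pos
  have hn' : (0 : ℝ) < n := Nat.cast_pos.2 hn
  have hd' : (0 : ℝ) < d := (mul_pos hN hl).trans_le hd
  have hr : (2 : ℝ)⁻¹ ^ m ≤ (n : ℝ)⁻¹ := by
    rw [inv_pow]
    exact inv_anti₀ hn' (by exact_mod_cast hnm)
  -- Each term is bounded after squaring. The three terms get the budgets `2`, `2` and `1` over
  -- `√l`, which sum to `5 ≤ 7`.
  have hle : ∀ {a c : ℝ}, 0 ≤ c → a ^ 2 * l ≤ c ^ 2 → a ≤ c / √l := fun {a c} hc h => by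
    rw [le_div_iff₀ (Real.sqrt_pos.2 hl)]
    refine abs_le_of_sq_le_sq' ?_ hc |>.2
    rwa [mul_pow, Real.sq_sqrt hl.le]
  have t1 : √(tailRatio / d) * ((2 : ℝ)⁻¹ ^ m * √(12 * n * n)) ≤ 2 / √l := by
    apply hle (by norm_num)
    rw [mul_pow, mul_pow, Real.sq_sqrt (by positivity), Real.sq_sqrt (by positivity)]
    have h5 : ((2 : ℝ)⁻¹ ^ m) ^ 2 * (12 * n * n) ≤ 12 := by
      calc ((2 : ℝ)⁻¹ ^ m) ^ 2 * (12 * n * n) ≤ ((n : ℝ)⁻¹) ^ 2 * (12 * n * n) := by gcongr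
        _ = 12 := by field_simp
    have h6 : tailRatio / d * l ≤ 1 / 4 := by
      rw [div_mul_eq_mul_div, div_le_iff₀ hd']
      nlinarith
    calc tailRatio / d * (((2 : ℝ)⁻¹ ^ m) ^ 2 * (12 * n * n)) * l
        = (tailRatio / d * l) * (((2 : ℝ)⁻¹ ^ m) ^ 2 * (12 * n * n)) := by ring
      _ ≤ 1 / 4 * 12 := mul_le_mul h6 h5 (by positivity) (by norm_num)
      _ ≤ 2 ^ 2 := by norm_num
  have t2 : √(tailRatio / d) * (√(12 * d) * δ) ≤ 2 / √l := by
    apply hle (by norm_num)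
    rw [mul_pow, mul_pow, Real.sq_sqrt (by positivity), Real.sq_sqrt (by positivity)]
    calc tailRatio / d * (12 * d * δ ^ 2) * l = 12 * tailRatio * l * δ ^ 2 := by field_simp
      _ ≤ 12 * tailRatio * l * (N / n) := by gcongr
      _ = 4 * (3 * tailRatio * (N * l)) / n := by ring
      _ ≤ 2 ^ 2 := by rw [div_le_iff₀ hn']; linarith
  have t3 : √n * (2 : ℝ)⁻¹ ^ m ≤ 1 / √l := by
    apply hle (by norm_num)
    rw [mul_pow, Real.sq_sqrt hn'.le]
    calc n * ((2 : ℝ)⁻¹ ^ m) ^ 2 * l ≤ n * ((n : ℝ)⁻¹) ^ 2 * n := by gcongr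
      _ = 1 ^ 2 := by field_simp
  have h0 : 0 ≤ 2 / √l := by positivity
  calc _ ≤ 2 / √l + 2 / √l + 1 / √l := by rw [mul_add]; exact add_le_add (add_le_add t1 t2) t3
    _ = 5 / √l := by ring
    _ ≤ 7 / √l := by gcongr; norm_num

end Asymptotics

/-- For an optimal computer, every vector of the `ℓ_p` ball is close to a low-complexity vector. -/
lemma exists_mem_lowComplexity_near {U : PrefixComputer} {c : ℕ}
    (hc : ∀ (s : List Bool) (y : ℕ × ℕ), condK U s y ≤ condK sparseComputer s y + (c : ℕ∞))
    {p : ℝ} (hp0 : 0 < p) (hp1 : p < 1) {n m : ℕ} (hn : 0 < n) (hnm : n ≤ 2 ^ m)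
    (hm : c + 2 ≤ m) {xo : EuclideanSpace ℝ (Fin n)} (hx : xo ∈ unitCube n) (hxp : xo ∈ lpBall p n) :
    ∃ y ∈ lowComplexity U m (3 * (n : ℝ) ^ (p / 2)) n,
      ‖xo - y‖ ^ 2 ≤ (n : ℝ) ^ (p / 2 - 1) := by
  obtain ⟨y, hy, T, hT, hcard, hnear⟩ := exists_sparse_approx hn hp0 hp1 hx hxp
  obtain ⟨u, hu, hclose, s, hs, hK⟩ :=
    exists_condK_sparseComputer_le (by omega) hnm y hy T hT
  refine ⟨y, (mem_lowComplexity_iff (by positivity)).2 ⟨hy, u, hu, hclose, s, hs, ?_⟩, hnear⟩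
  refine (hc s (n, m)).trans ((add_le_add_left hK _).trans ?_)
  have hN : (1 : ℝ) ≤ (n : ℝ) ^ (p / 2) :=
    Real.one_le_rpow (by exact_mod_cast hn) (by positivity)
  have hm' : (c : ℝ) + 2 ≤ m := by exact_mod_cast hm
  have : T.card + 1 + 2 * m * T.card + c ≤ ⌊3 * (n : ℝ) ^ (p / 2) * m⌋₊ := by
    apply Nat.le_floor
    push_cast
    -- With `N = n^(p/2) ≥ 1` it remains to see `N + 1 + c ≤ N * m`, which follows from `m ≥ c + 2`.
    have h1 : (T.card : ℝ) * (1 + 2 * m) ≤ (n : ℝ) ^ (p / 2) * (1 + 2 * m) := by gcongr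
    nlinarith
  exact_mod_cast this

end MCP
end

/-! ### The main theorem -/

theorem proposition6 (U : MCP.PrefixComputer) (hU : MCP.IsOptimal U)
    (p : ℝ) (hp0 : 0 < p) (hp1 : p < 1)
    (b : ℝ) (hb : b = 2 ∨ b = Real.exp 1) :
    ∀ᶠ n : ℕ in atTop, ∀ d m : ℕ,
      d = ⌈3 * (n : ℝ) ^ (p / 2) * Real.logb b n⌉₊ →
      m = ⌈Real.logb 2 n⌉₊ →
      ∀ xo : EuclideanSpace ℝ (Fin n), xo ∈ MCP.unitCube n → xo ∈ MCP.lpBall p n →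
        (∀ A : Matrix (Fin d) (Fin n) ℝ, ∃ xhat : EuclideanSpace ℝ (Fin n),
          MCP.IsLLSSolution U m (3 * (n : ℝ) ^ (p / 2)) A (MCP.meas A xo) xhat) ∧
        ∀ (Ω : Type*) [MeasurableSpace Ω] (P : Measure Ω) [IsProbabilityMeasure P]
          (A : Ω → Matrix (Fin d) (Fin n) ℝ) (xhat : Ω → EuclideanSpace ℝ (Fin n)),
          MCP.IsStdGaussianMatrix P A →
          (∀ᵐ ω ∂P, MCP.IsLLSSolution U m (3 * (n : ℝ) ^ (p / 2)) (A ω)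
            (MCP.meas (A ω) xo) (xhat ω)) →
          P {ω | 7 / √(Real.logb b n) < ‖xo - xhat ω‖} ≤
            ENNReal.ofReal (2 * Real.exp (-0.5 * d)) := by
  obtain ⟨c, hc⟩ := hU MCP.sparseComputer
  have hτ := MCP.tailRatio_pos
  have hlog : Tendsto (fun n : ℕ => Real.log n) atTop atTop :=
    Real.tendsto_log_atTop.comp tendsto_natCast_atTop_atTop
  have hpow : Tendsto (fun n : ℕ => (n : ℝ) ^ (p / 2)) atTop atTop :=
    (tendsto_rpow_atTop (by linarith)).comp tendsto_natCast_atTop_atTop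
  -- `log n ≥ c + 10` yields `m ≥ c + 2` and `d ≥ 30`; `N ≥ 4 * tailRatio` handles the quantization
  -- term; the constant `12` gives `d ≤ n`; the constant `6 * tailRatio` handles the approximation
  -- term, with a factor `2` for the base of the logarithm.
  filter_upwards [eventually_gt_atTop 0, hlog.eventually_ge_atTop ((c : ℝ) + 10),
    hpow.eventually_ge_atTop (4 * MCP.tailRatio),
    MCP.eventually_rpow_mul_log_le (q := p / 2) (by linarith) (C := 12) (by norm_num),
    MCP.eventually_rpow_mul_log_le (q := p / 2) (by linarith) (C := 6 * MCP.tailRatio)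
      (by positivity)] with n hn hlogn hNτ h12 h6τ d m hd hm xo hx hxp
  have hn' : (0 : ℝ) < n := Nat.cast_pos.2 hn
  have hc0 : (0 : ℝ) ≤ c := Nat.cast_nonneg c
  set N : ℝ := (n : ℝ) ^ (p / 2) with hNdef
  set l : ℝ := Real.logb b n with hldef
  have hN1 : 1 ≤ N := Real.one_le_rpow (by exact_mod_cast hn) (by positivity)
  obtain ⟨hl1, hl2⟩ := MCP.log_le_logb_le hb (x := n) (by linarith)
  obtain ⟨hL1, -⟩ := MCP.log_le_logb_le (b := 2) (Or.inl rfl) (x := n) (by linarith)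
  have hnm : n ≤ 2 ^ m := hm ▸ MCP.le_two_pow_ceil_logb hn
  have hmlow : Real.log n ≤ m := hL1.trans (hm ▸ Nat.le_ceil _)
  have hmup : (m : ℝ) ≤ Real.logb 2 n + 1 :=
    hm ▸ (Nat.ceil_lt_add_one (by linarith)).le
  have hcm : c + 2 ≤ m := by
    have : (c : ℝ) + 2 ≤ m := by linarith
    exact_mod_cast this
  have hNl : N * Real.log n ≤ N * l := by gcongr
  have hNl2 : N * l ≤ 2 * (N * Real.log n) := by nlinarith
  have hN10 : 10 * N ≤ N * Real.log n := by nlinarith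
  have hdlow : 3 * N * l ≤ d := hd ▸ Nat.le_ceil _
  have hdup : (d : ℝ) ≤ 3 * N * l + 1 := hd ▸ (Nat.ceil_lt_add_one (by nlinarith)).le
  have hdn : d ≤ n := by
    have : (d : ℝ) ≤ n := by linarith
    exact_mod_cast this
  have hd30 : (30 : ℝ) ≤ d := by linarith
  have hd0 : 0 < d := Nat.cast_pos.1 (lt_of_lt_of_le (by norm_num : (0 : ℝ) < 30) hd30)
  obtain ⟨y, hy, hnear⟩ :=
    MCP.exists_mem_lowComplexity_near hc hp0 hp1 hn hnm hcm hx hxp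
  refine ⟨fun A => MCP.exists_isLLSSolution U (by positivity) ⟨y, hy⟩ A _,
    fun Ω _ P _ A xhat hA hsol => ?_⟩
  refine (MCP.measure_error_le hA (by positivity) hd0 hdn ?_ hy hsol
    (MCP.error_terms_le hn hnm (by positivity) (by linarith) (by linarith) ?_ hNτ
      (by nlinarith) (by nlinarith))).trans ?_
  -- Number of candidates: `(3Nm + 1) log 2 ≤ 3N log n + 3N + 1 ≤ 2d`, since `m ≤ log₂ n + 1` and `d
  -- ≥ 3N log n`.
  · have hlog2 : Real.log 2 ≤ 1 := by linarith [Real.log_two_lt_d9]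
    have hlog2' : 0 < Real.log 2 := Real.log_pos (by norm_num)
    have hfloor : (⌊3 * N * m⌋₊ : ℝ) ≤ 3 * N * m := Nat.floor_le (by positivity)
    have hlogb : Real.logb 2 n * Real.log 2 = Real.log n :=
      div_mul_cancel₀ _ hlog2'.ne'
    rw [← Real.log_le_iff_le_exp (by positivity), Real.log_pow]
    push_cast
    calc (⌊3 * N * m⌋₊ + 1 : ℝ) * Real.log 2
        ≤ (3 * N * (Real.logb 2 n + 1) + 1) * Real.log 2 := by
          refine mul_le_mul_of_nonneg_right (add_le_add_left (hfloor.trans ?_) 1) hlog2'.le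
          gcongr
      _ = 3 * N * (Real.logb 2 n * Real.log 2) + (3 * N + 1) * Real.log 2 := by ring
      _ ≤ 3 * N * Real.log n + (3 * N + 1) * 1 := by
          rw [hlogb]
          gcongr
      _ ≤ 2 * d := by linarith
  · rwa [Real.rpow_sub_one hn'.ne'] at hnear
  · refine ENNReal.ofReal_le_ofReal ?_
    have h1 : Real.exp (-(d : ℝ)) = Real.exp (-0.5 * d) * Real.exp (-0.5 * d) := by
      rw [← Real.exp_add]; ring_nf
    -- This is what reduces `3e^(-d)` to `2e^(-d/2)`.
    have h2 : Real.exp (-0.5 * d) ≤ 2 / 3 := by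
      rw [show -0.5 * (d : ℝ) = -(0.5 * d) by ring, Real.exp_neg]
      have := Real.add_one_le_exp (0.5 * (d : ℝ))
      rw [inv_le_comm₀ (Real.exp_pos _) (by norm_num)]
      norm_num at this ⊢
      linarith
    have h3 := Real.exp_pos (-0.5 * (d : ℝ))
    rw [h1]
    nlinarith
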